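/- Let $R$ be an associative ring with identity and let $M$ be a unital $R$-module (on one fixed side). Let $E(M)$ denote the injective hull of $M$, i.e. an injective module containing $M$ as an essential submodule. Suppose that $M$ is automorphism-invariant, i.e. $\varphi(M)\subseteq M$ for every automorphism $\varphi$ of $E(M)$. A nonzero module is called indecomposable if its only direct summands are $0$ and the module itself. Let $M=\bigoplus_{i\in I}M_i$ be a decomposition of $M$ as an internal direct sum of indecomposable submodules, where $I$ is an arbitrary index set. Then: 1. For every $i\in I$ the endomorphism ring $\operatorname{End}_R(M_i)$ is a local ring. 2. The decomposition complements direct summands: for every direct summand $N$ of $M$ there is a subset $I'\subseteq I$ such that $M=N\oplus\bigl(\bigoplus_{i\in I'}M_i\bigr)$. 3. The decomposition is unique up to isomorphism in the sense of Krull–Remak–Schmidt: if $M=\bigoplus_{k\in K}N_k$ is any decomposition of $M$ as an internal direct sum of indecomposable submodules, then there is a bijection $\sigma:I\to K$ such that $M_i\cong N_{\sigma(i)}$ for every $i\in I$. -/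

import Mathlib

universe u v w

/-- `f : M → E` is an injective hull of `M`: it is a monomorphism into an injective module
whose image is an essential submodule of `E`. -/
structure IsInjectiveHull (R : Type u) [Ring R] {M : Type v} [AddCommGroup M] [Module R M]
    {E : Type w} [AddCommGroup E] [Module R E] (f : M →ₗ[R] E) : Prop where
  injective_module : Module.Injective R E
  injective_map : Function.Injective f
  essential : ∀ L : Submodule R E, L ⊓ LinearMap.range f = ⊥ → L = ⊥

/-- `M` is automorphism-invariant: (its image in) its injective hull `E(M)` is mapped into itself
by every automorphism of `E(M)`. Injective hulls exist in `Type (max u v)` and are unique up to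
an isomorphism over `M`, so it does not matter which of them is taken. -/
def IsAutomorphismInvariant (R : Type u) [Ring R] (M : Type v) [AddCommGroup M] [Module R M] :
    Prop :=
  ∃ (E : Type (max u v)) (_ : AddCommGroup E) (_ : Module R E) (f : M →ₗ[R] E),
    IsInjectiveHull R f ∧
      ∀ φ : E ≃ₗ[R] E, (LinearMap.range f).map φ.toLinearMap ≤ LinearMap.range f

/-- A nonzero module whose only direct summands are `0` and the module itself. -/
structure IsIndecomposableModule (R : Type u) [Ring R] (M : Type v) [AddCommGroup M]
    [Module R M] : Prop where
  nontrivial : Nontrivial M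
  eq_bot_or_eq_top : ∀ L : Submodule R M, IsComplemented L → L = ⊥ ∨ L = ⊤

/-- `M` is the internal direct sum of the submodules `N i`, and each `N i` is indecomposable. -/
structure IsIndecomposableDecomposition {R : Type u} [Ring R] {M : Type v} [AddCommGroup M]
    [Module R M] {ι : Type w} [DecidableEq ι] (N : ι → Submodule R M) : Prop where
  isInternal : DirectSum.IsInternal N
  indecomposable : ∀ i, IsIndecomposableModule R (N i)

/-- The decomposition `M = ⨁ i, N i` complements direct summands: for every direct summand `K`
of `M` there is a set `s` of indices with `M = K ⊕ (⨁ i ∈ s, N i)`. -/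
def ComplementsDirectSummands {R : Type u} [Ring R] {M : Type v} [AddCommGroup M]
    [Module R M] {ι : Type w} (N : ι → Submodule R M) : Prop :=
  ∀ K : Submodule R M, IsComplemented K → ∃ s : Set ι, IsCompl K (⨆ i ∈ s, N i)

/-! Everything happens inside the injective hull E, with M an essential submodule stable under
automorphisms. Then M is also preserved by every square-zero s (since 1 + s is invertible), by every
s with essential kernel (since 1 - s is), and by every idempotent whose range embeds in its own
kernel, being a product of two square-zero maps.

An indecomposable summand of M gives an idempotent e of E onto a hull of that summand. The range of
e may decompose further in E, but e is primitive among the idempotents preserving M. Hence maps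
between complementary pieces of the range of e have essential kernel
(`PrimIdem.essKer_of_orthogonal`): otherwise a proper piece would embed in its complement and its
idempotent would preserve M. So an endomorphism of the range of e that preserves M either has
essential kernel or is invertible (`PrimIdem.essKer_or_inverse`). This gives local endomorphism
rings.

For a summand K, choose a maximal set of indices whose summands have sum V disjoint from K. Either e
has uniform range or every map from its range to its kernel has essential kernel; both cases make K
+ V essential (`exists_complement`), and stability of M upgrades essential to equal
(`le_sup_of_essIn`). Uniqueness is Azumaya's theorem: for each A with local endomorphism ring, the
summands isomorphic to A index a basis of a vector space over the residue division ring, and the two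
decompositions give isomorphic spaces. -/

namespace AutInvariant

/-! ### Essential kernels and hull idempotents in an injective module. -/

section Ambient

variable {R : Type u} [Ring R] {E : Type w} [AddCommGroup E] [Module R E]

/-- `X` meets every nonzero submodule of `Y` nontrivially. -/
def EssIn (X Y : Submodule R E) : Prop :=
  ∀ y ∈ Y, y ≠ 0 → ∃ r : R, r • y ∈ X ∧ r • y ≠ 0

/-- The kernel of `s` is an essential submodule. -/
def EssKer (s : Module.End R E) : Prop :=
  ∀ x, x ≠ 0 → ∃ r : R, r • x ≠ 0 ∧ s (r • x) = 0

/-- `s` maps `M` into itself. -/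
def Preserves (M : Submodule R E) (s : Module.End R E) : Prop :=
  ∀ x ∈ M, s x ∈ M

/-- `f` is an idempotent of the corner ring defined by `e`. -/
structure CornerIdem (e f : Module.End R E) : Prop where
  idem : ∀ x, f (f x) = f x
  left : ∀ x, e (f x) = f x
  right : ∀ x, f (e x) = f x

theorem essIn_of_disjoint {X Y : Submodule R E}
    (h : ∀ Z ≤ Y, Disjoint X Z → Z = ⊥) : EssIn X Y := by
  intro y hy hy0
  by_contra! hc
  have := h (Submodule.span R {y}) (by simpa using hy) (by
    rw [Submodule.disjoint_def]
    intro x hx hxy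
    obtain ⟨r, rfl⟩ := Submodule.mem_span_singleton.1 hxy
    exact hc r hx)
  exact hy0 (by simpa using this)

theorem EssKer.add {s t : Module.End R E} (hs : EssKer s) (ht : EssKer t) : EssKer (s + t) := by
  intro x hx
  obtain ⟨r, hr, hr'⟩ := hs x hx
  obtain ⟨q, hq, hq'⟩ := ht _ hr
  refine ⟨q * r, by rwa [mul_smul], ?_⟩
  rw [mul_smul, LinearMap.add_apply, hq', map_smul, hr', smul_zero, add_zero]

theorem EssKer.mul_left {s : Module.End R E} (hs : EssKer s) (t : Module.End R E) :
    EssKer (t * s) := by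
  intro x hx
  obtain ⟨r, hr, hr'⟩ := hs x hx
  exact ⟨r, hr, by rw [Module.End.mul_apply, hr', map_zero]⟩

/-- A linear map into an injective module that is injective on `X` can be undone on `X`. -/
theorem exists_leftInverse_on [Module.Injective R E] (X : Submodule R E) (t : Module.End R E)
    (ht : ∀ x ∈ X, t x = 0 → x = 0) : ∃ h : Module.End R E, ∀ x ∈ X, h (t x) = x := by
  obtain ⟨h, hh⟩ := Module.Injective.out (t.domRestrict X)
    (by
      rw [injective_iff_map_eq_zero]
      rintro ⟨x, hx⟩ h
      exact Subtype.ext (ht x hx h)) X.subtype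
  exact ⟨h, fun x hx => hh ⟨x, hx⟩⟩

theorem exists_extension [Module.Injective R E] (X : Submodule R E) (g : X →ₗ[R] E) :
    ∃ h : Module.End R E, ∀ x : X, h x = g x :=
  Module.Injective.out X.subtype X.injective_subtype g

theorem exists_maximal_disjoint {X Z : Submodule R E} (hd : Disjoint X Z) :
    ∃ L, Z ≤ L ∧ Disjoint X L ∧ ∀ L', L ≤ L' → Disjoint X L' → L' = L := by
  obtain ⟨L, hZ, hL⟩ := zorn_le_nonempty₀ {L | Disjoint X L} (fun c hc hchain y hy =>
    ⟨sSup c, (hchain.directedOn.disjoint_sSup_right).2 fun b hb => hc hb,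
      fun z hz => le_sSup hz⟩) Z hd
  exact ⟨L, hZ, hL.prop, fun L' h h' => le_antisymm (hL.2 h' h) h⟩

/-- Disjoint submodules `X`, `Z` of an injective module are separated by an idempotent whose
range is an injective hull of `X`. -/
theorem exists_idem_of_disjoint [Module.Injective R E] {X Z : Submodule R E}
    (hd : Disjoint X Z) :
    ∃ e : Module.End R E, (∀ x, e (e x) = e x) ∧ (∀ x ∈ X, e x = x) ∧ (∀ z ∈ Z, e z = 0) ∧
      EssIn X (LinearMap.range e) := by
  obtain ⟨L, hZL, hXL, hL⟩ := exists_maximal_disjoint hd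
  obtain ⟨K, hXK, hLK, hK⟩ := exists_maximal_disjoint hXL.symm
  have hLK' := Submodule.disjoint_def.1 hLK
  have hXL' := Submodule.disjoint_def.1 hXL
  have hinj : Function.Injective (K.subtype.coprod L.subtype) := by
    rw [injective_iff_map_eq_zero]
    rintro ⟨k, l⟩ h
    simp only [LinearMap.coprod_apply, Submodule.subtype_apply] at h
    have hk : (k : E) = -l := eq_neg_of_add_eq_zero_left h
    have hk0 : (k : E) = 0 := hLK' _ (by rw [hk]; exact L.neg_mem l.2) k.2
    have hl0 : (l : E) = 0 := by simpa [hk0] using h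
    ext
    · exact hk0
    · exact hl0
  obtain ⟨e, he⟩ := Module.Injective.out _ hinj (K.subtype ∘ₗ LinearMap.fst R K L)
  have heK : ∀ x ∈ K, e x = x := fun x hx => by simpa using he (⟨x, hx⟩, 0)
  have heL : ∀ x ∈ L, e x = 0 := fun x hx => by simpa using he (0, ⟨x, hx⟩)
  -- `e` is only some extension of the projection of K ⊕ L onto K. Maximality of L, then of K,
  -- forces its range to be exactly K.
  have hY : L.comap e = L := hL _ (fun x hx => by simp [heL x hx]) (by
    rw [Submodule.disjoint_def]
    intro x hx hxe
    rw [Submodule.mem_comap, heK x (hXK hx)] at hxe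
    exact hXL' x hx hxe)
  have hrange : LinearMap.range e = K := hK _ (fun x hx => ⟨x, heK x hx⟩) (by
    rw [Submodule.disjoint_def]
    rintro _ hx ⟨x, rfl⟩
    have : x ∈ L.comap e := hx
    rw [hY] at this
    exact heL x this)
  refine ⟨e, fun x => heK _ (hrange ▸ LinearMap.mem_range_self e x), fun x hx => heK x (hXK hx),
    fun z hz => heL z (hZL hz), ?_⟩
  rw [hrange]
  refine essIn_of_disjoint fun Y hYK hXY => ?_
  -- A submodule of K disjoint from X could be added to L, so by maximality it lies in K ⊓ L.
  have : L ⊔ Y = L := hL _ le_sup_left (by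
    rw [Submodule.disjoint_def]
    intro x hx hxe
    obtain ⟨l, hl, y, hy, rfl⟩ := Submodule.mem_sup.1 hxe
    have hl0 : l = 0 := hLK' l hl (by
      simpa using K.sub_mem (hXK hx) (hYK hy))
    subst hl0
    rw [zero_add] at hx ⊢
    exact Submodule.disjoint_def.1 hXY _ hx hy)
  rw [Submodule.eq_bot_iff]
  intro y hy
  exact hLK' y (this ▸ (le_sup_right : Y ≤ L ⊔ Y) hy) (hYK hy)

/-- Injective hulls inside a direct summand of an injective module. -/
theorem exists_cornerIdem [Module.Injective R E] {f : Module.End R E}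
    (hf : ∀ x, f (f x) = f x) {X : Submodule R E} (hX : ∀ x ∈ X, f x = x) :
    ∃ h, CornerIdem f h ∧ (∀ x ∈ X, h x = x) ∧ EssIn X (LinearMap.range h) := by
  -- Killing the kernel of `f` gives `h f = h`, which makes `f * h` an idempotent of the corner.
  obtain ⟨h, hh, hX', hker, hess⟩ := exists_idem_of_disjoint (X := X) (Z := LinearMap.ker f) (by
    rw [Submodule.disjoint_def]
    intro x hx hxf
    rw [← hX x hx]
    exact hxf)
  have hhf : ∀ x, h (f x) = h x := fun x => by
    have : h (x - f x) = 0 := hker _ (by simp [hf])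
    rw [map_sub, sub_eq_zero] at this
    exact this.symm
  refine ⟨f * h, ⟨?_, ?_, ?_⟩, ?_, ?_⟩
  · intro x; simp [hhf, hh]
  · intro x; simp [hf]
  · intro x; simp [hhf]
  · intro x hx; simp [hX' x hx, hX x hx]
  · rintro _ ⟨x, rfl⟩ hx
    have h0 : h x ≠ 0 := fun h0 => hx (by simp [h0])
    obtain ⟨r, hr, hr0⟩ := hess _ ⟨x, rfl⟩ h0
    have key : r • (f * h) x = r • h x := by
      rw [Module.End.mul_apply, ← map_smul, hX _ hr]
    exact ⟨r, key ▸ hr, key ▸ hr0⟩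

/-! ### Endomorphisms that preserve an automorphism-stable submodule. -/

/-- `M` is mapped into itself by every automorphism of the ambient module. -/
def AutStable (M : Submodule R E) : Prop :=
  ∀ φ : E ≃ₗ[R] E, ∀ x ∈ M, φ x ∈ M

theorem Preserves.add {M : Submodule R E} {s t : Module.End R E} (hs : Preserves M s)
    (ht : Preserves M t) : Preserves M (s + t) :=
  fun x hx => M.add_mem (hs x hx) (ht x hx)

theorem Preserves.sub {M : Submodule R E} {s t : Module.End R E} (hs : Preserves M s)
    (ht : Preserves M t) : Preserves M (s - t) :=
  fun x hx => M.sub_mem (hs x hx) (ht x hx)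

theorem Preserves.mul {M : Submodule R E} {s t : Module.End R E} (hs : Preserves M s)
    (ht : Preserves M t) : Preserves M (s * t) :=
  fun x hx => hs _ (ht x hx)

theorem Preserves.one (M : Submodule R E) : Preserves M 1 := fun _ hx => hx

theorem AutStable.of_inverse {M : Submodule R E} (hM : AutStable M) {u v : Module.End R E}
    (huv : ∀ x, u (v x) = x) (hvu : ∀ x, v (u x) = x) : Preserves M u :=
  fun x hx => hM (LinearEquiv.ofLinearMap u v (LinearMap.ext huv) (LinearMap.ext hvu)) x hx

theorem AutStable.of_sq_zero {M : Submodule R E} (hM : AutStable M) {s : Module.End R E}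
    (hs : ∀ x, s (s x) = 0) : Preserves M s := by
  have h : Preserves M (1 + s) := hM.of_inverse (v := 1 - s) (by intro x; simp [hs])
    (by intro x; simp [hs])
  simpa using h.sub (Preserves.one M)

/-- The map 1 - s is the identity on an essential submodule, so it is injective and has a left
inverse h. For surjectivity, h kills every defect y - (1 - s)(h y), yet fixes any multiple of it
killed by s; so the defect is zero. -/
theorem AutStable.of_essKer [Module.Injective R E] {M : Submodule R E} (hM : AutStable M)
    {s : Module.End R E} (hs : EssKer s) : Preserves M s := by
  obtain ⟨h, hh⟩ := exists_leftInverse_on (⊤ : Submodule R E) (1 - s) (by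
    intro x _ hx
    by_contra hx0
    obtain ⟨r, hr, hr'⟩ := hs x hx0
    have : x = s x := by simpa [sub_eq_zero] using hx
    rw [map_smul, ← this] at hr'
    exact hr hr')
  have hh' : ∀ x, h ((1 - s) x) = x := fun x => hh x trivial
  have key : Preserves M (1 - s) := hM.of_inverse (v := h) (by
    intro y
    by_contra hy
    have hz : y - (1 - s) (h y) ≠ 0 := fun h0 => hy (sub_eq_zero.1 h0).symm
    obtain ⟨r, hr, hr'⟩ := hs _ hz
    have h1 := hh' (r • (y - (1 - s) (h y)))
    rw [LinearMap.sub_apply, hr', sub_zero, Module.End.one_apply, map_smul, map_sub, hh',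
      sub_self, smul_zero] at h1
    exact hr h1.symm) hh'
  simpa using (Preserves.one M).sub key

/-- If an endomorphism maps the range of an idempotent `e` injectively into the kernel of `e`,
then `e` is a product of two square-zero endomorphisms. -/
theorem exists_sq_zero_factorization [Module.Injective R E] {e t : Module.End R E}
    (he : ∀ x, e (e x) = e x) (ht : ∀ x, t (e x) = 0 → e x = 0) (hete : ∀ x, e (t (e x)) = 0) :
    ∃ k : Module.End R E, (∀ x, k (t (e x)) = e x) ∧ (∀ x, e (k x) = k x) ∧
      (∀ x, k (e x) = 0) := by
  obtain ⟨h, hh⟩ := exists_leftInverse_on (LinearMap.range e) t (by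
    rintro _ ⟨x, rfl⟩ hx; exact ht x hx)
  -- The factor `1 - e` changes nothing on the kernel of `e`, where `t e` takes its values, and
  -- makes the map vanish on the range of `e`.
  exact ⟨e * h * (1 - e), fun x => by simp [hete, hh _ ⟨x, rfl⟩, he], fun x => by simp [he],
    fun x => by simp [he]⟩

theorem AutStable.of_injective_to_ker [Module.Injective R E] {M : Submodule R E}
    (hM : AutStable M) {e t : Module.End R E}
    (he : ∀ x, e (e x) = e x) (ht : ∀ x, t (e x) = 0 → e x = 0) (hete : ∀ x, e (t (e x)) = 0) :
    Preserves M e := by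
  obtain ⟨k, hk, hek, hke⟩ := exists_sq_zero_factorization he ht hete
  have h1 : Preserves M (t * e) := hM.of_sq_zero (by intro x; simp [hete])
  have h2 : Preserves M k := hM.of_sq_zero (by intro x; rw [← hek x, hke])
  have : e = k * (t * e) := LinearMap.ext fun x => (hk x).symm
  rw [this]
  exact h2.mul h1

/-! ### Primitive idempotents and locality modulo essential kernels. -/

/-- A primitive idempotent of the ring of endomorphisms preserving `M`. -/
structure PrimIdem (M : Submodule R E) (e : Module.End R E) : Prop where
  idem : ∀ x, e (e x) = e x
  ne_zero : e ≠ 0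
  preserves : Preserves M e
  eq_zero_or_eq : ∀ f, CornerIdem e f → Preserves M f → f = 0 ∨ f = e

theorem CornerIdem.trans {e f h : Module.End R E} (hf : CornerIdem e f) (hh : CornerIdem f h) :
    CornerIdem e h where
  idem := hh.idem
  left x := by rw [← hh.left x, hf.left]
  right x := by rw [← hh.right (e x), hf.right, hh.right]

theorem CornerIdem.sub {e f : Module.End R E} (he : ∀ x, e (e x) = e x) (hf : CornerIdem e f) :
    CornerIdem e (e - f) where
  idem x := by simp [he, hf.left, hf.right, hf.idem]
  left x := by simp [he, hf.left]
  right x := by simp [he, hf.right]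

/-- If `g` does not have essential kernel and `g = g f`, there is a nonzero idempotent of the
corner of `f` on the range of which `g` is injective. -/
theorem exists_cornerIdem_injective [Module.Injective R E] {f g : Module.End R E}
    (hf : ∀ x, f (f x) = f x) (hgf : ∀ x, g (f x) = g x) (hg : ¬ EssKer g) :
    ∃ h, CornerIdem f h ∧ h ≠ 0 ∧ ∀ x, g (h x) = 0 → h x = 0 := by
  simp only [EssKer, not_forall, not_exists, not_and] at hg
  obtain ⟨x, hx, hgx⟩ := hg
  -- No nonzero multiple of `x` is killed by `g`, so `g` is injective on the span of `f x`, hence on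
  -- its hull.
  obtain ⟨h, hfh, hX, hess⟩ := exists_cornerIdem hf (X := Submodule.span R {f x}) (by
    intro y hy
    obtain ⟨r, rfl⟩ := Submodule.mem_span_singleton.1 hy
    rw [map_smul, hf])
  have hgx0 : g x ≠ 0 := by simpa [hx] using hgx 1
  have hfx : f x ≠ 0 := fun h0 => hgx0 (by rw [← hgf, h0, map_zero])
  refine ⟨h, hfh, ?_, ?_⟩
  · rintro rfl
    exact hfx (by simpa using (hX (f x) (Submodule.mem_span_singleton_self _)).symm)
  · intro y hy
    by_contra hy0
    obtain ⟨r, hr, hr0⟩ := hess _ ⟨y, rfl⟩ hy0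
    obtain ⟨q, hq⟩ := Submodule.mem_span_singleton.1 hr
    have h1 : g (q • x) = 0 := by
      rw [← hgf, map_smul, hq, map_smul, hy, smul_zero]
    by_cases h2 : q • x = 0
    · rw [← hq, ← map_smul, h2, map_zero] at hr0
      exact hr0 rfl
    · exact hgx q h2 h1

/-- If the kernel of g were not essential, g would embed the range of some nonzero h, in the corner
of f, into the kernel of h. Such an h preserves M, so primitivity gives h = e; then f fixes the
range of e, which forces g = 0. -/
theorem PrimIdem.essKer_of_orthogonal [Module.Injective R E] {M : Submodule R E}
    (hM : AutStable M) {e f g : Module.End R E} (he : PrimIdem M e) (hf : CornerIdem e f)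
    (hgf : ∀ x, g (f x) = g x) (hfg : ∀ x, f (g x) = 0) (heg : ∀ x, e (g x) = g x) :
    EssKer g := by
  by_contra hg
  obtain ⟨h, hh, h0, hinj⟩ := exists_cornerIdem_injective hf.idem hgf hg
  have hp : Preserves M h := hM.of_injective_to_ker hh.idem hinj (fun x => by
    rw [← hh.right, hfg, map_zero])
  rcases he.eq_zero_or_eq h (hf.trans hh) hp with rfl | rfl
  · exact h0 rfl
  · apply hg
    intro x hx
    refine ⟨1, by simpa using hx, ?_⟩
    rw [one_smul, ← heg, ← hh.left, heg, hfg]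

theorem EssKer.congr {s t : Module.End R E} (hs : EssKer s) (h : ∀ x, s x = t x) : EssKer t := by
  rwa [show t = s from LinearMap.ext fun x => (h x).symm]

/-- The corner of a primitive idempotent is local modulo the ideal of endomorphisms with
essential kernel. -/
theorem PrimIdem.essKer_or_inverse [Module.Injective R E] {M : Submodule R E}
    (hM : AutStable M) {e s : Module.End R E} (he : PrimIdem M e) (hs : Preserves M s)
    (hes : ∀ x, e (s x) = s x) (hse : ∀ x, s (e x) = s x) :
    EssKer s ∨ ∃ v : Module.End R E, Preserves M v ∧ (∀ x, e (v x) = v x) ∧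
      (∀ x, v (e x) = v x) ∧ (∀ x, s (v x) = e x) ∧ (∀ x, v (s x) = e x) := by
  -- Split `e = c + h` with `h` onto a hull of the kernel of `s`: then `s h` has essential kernel
  -- and `s` is injective on the range of `c`. It remains to see that `c s c` is invertible in its
  -- corner and that `c` preserves M.
  obtain ⟨h, heh, hX, hess⟩ := exists_cornerIdem he.idem
    (X := LinearMap.ker s ⊓ LinearMap.range e) (by rintro _ ⟨_, ⟨x, rfl⟩⟩; exact he.idem x)
  have hec : CornerIdem e (e - h) := heh.sub he.idem
  have hsum : ∀ x, (e - h) x + h x = e x := fun x => by simp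
  have hhc : ∀ x, h ((e - h) x) = 0 := fun x => by simp [heh.right, heh.idem]
  have hch : ∀ x, (e - h) (h x) = 0 := fun x => by simp [heh.left, heh.idem]
  generalize e - h = c at hec hsum hhc hch
  have hsh : EssKer (s * h) := by
    intro x hx
    by_cases h0 : h x = 0
    · exact ⟨1, by simpa using hx, by simp [h0]⟩
    · obtain ⟨r, hr, hr0⟩ := hess _ ⟨x, rfl⟩ h0
      refine ⟨r, fun hrx => hr0 (by rw [← map_smul, hrx, map_zero]), ?_⟩
      rw [Module.End.mul_apply, map_smul]
      exact hr.1
  have hsc : ∀ x, s (c x) = 0 → c x = 0 := fun x hx => by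
    rw [← hX (c x) ⟨hx, ⟨c x, hec.left x⟩⟩, hhc]
  have hhsc : EssKer (h * s * c) := he.essKer_of_orthogonal hM hec
    (fun x => by simp [hec.idem]) (fun x => by simp [hch]) (fun x => by simp [heh.left])
  have hcsc : ∀ x, c (s (c x)) = 0 → c x = 0 := fun x hx => by
    by_contra hx0
    obtain ⟨r, hr, hr0⟩ := hhsc _ hx0
    have h1 : s (c (r • c x)) = 0 := by
      have hr0' : h (s (c (r • c x))) = 0 := hr0
      rw [← hes, ← hsum, hr0', add_zero]
      simp [hec.idem, hx]
    have h2 := hsc _ h1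
    rw [map_smul, hec.idem] at h2
    exact hr h2
  obtain ⟨v₀, hv₀⟩ := exists_leftInverse_on (LinearMap.range c) (c * s) (by
    rintro _ ⟨x, rfl⟩ hx; exact hcsc x hx)
  obtain ⟨v, hcv, hvc, hv⟩ : ∃ v : Module.End R E, (∀ x, c (v x) = v x) ∧ (∀ x, v (c x) = v x) ∧
      ∀ x, v (s (c x)) = c x := by
    refine ⟨c * v₀ * c, fun x => by simp [hec.idem], fun x => by simp [hec.idem], fun x => ?_⟩
    have := hv₀ _ ⟨x, rfl⟩
    rw [Module.End.mul_apply] at this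
    simp [this, hec.idem]
  have hcd : CornerIdem c (c * s * v) :=
    ⟨fun x => by
      have := hv (v x)
      rw [hcv] at this
      simp [hvc, this], fun x => by simp [hec.idem], fun x => by simp [hvc]⟩
  have hcd' := hcd.sub hec.idem
  have hd's : ∀ x, (c - c * s * v) (s (c x)) = 0 := fun x => by simp [hv]
  have hdd : ∀ x, (c - c * s * v) x = c x - c (s (v x)) := fun x => by simp
  generalize c - c * s * v = d at hcd' hd's hdd
  -- `d` projects onto a complement of the image of `c s c`. By orthogonality `c s d` has essential
  -- kernel, while `c s` is injective on the range of `c`; so `d` vanishes.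
  have hd0 : ∀ x, d x = 0 := by
    have hg : EssKer (c * s * d) := he.essKer_of_orthogonal hM (hec.trans hcd')
      (fun x => by simp [hcd'.idem]) (fun x => by
        have := hd's (d x)
        rw [hcd'.left] at this
        simp [hcd'.right, this]) (fun x => by simp [hec.left])
    intro x
    by_contra hx
    obtain ⟨r, hr, hr0⟩ := hg _ hx
    have h1 := hcsc (r • d x) (by
      simpa [map_smul, hcd'.left, hcd'.idem] using hr0)
    rw [map_smul, hcd'.left] at h1
    exact hr h1
  have hv' : ∀ x, c (s (v x)) = c x := fun x => by
    have := hdd x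
    rw [hd0, eq_comm, sub_eq_zero] at this
    exact this.symm
  have hw : Preserves M (1 - c + v) := hM.of_inverse (v := 1 - c + c * s * c)
    (fun x => by simp [hec.idem, hv, hvc]) (fun x => by simp [hec.idem, hcv, hv'])
  have hj : EssKer ((1 - c + v) * (s * h) + (1 - c + v) * (h * s * c)) :=
    (hsh.mul_left _).add (hhsc.mul_left _)
  -- Modulo essential kernels `s` is `c s c`, which the automorphism `1 - c + v` turns into `c`. So
  -- `c` differs from a map preserving M by one with essential kernel.
  have hcM : Preserves M c := by
    have h1 := (hw.mul hs).sub (hM.of_essKer hj)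
    convert h1 using 1
    ext x
    have e1 : s x = s (c x) + s (h x) := by rw [← hse, ← hsum, map_add]
    have e2 : s (c x) = c (s (c x)) + h (s (c x)) := by rw [hsum, hes]
    have e3 : (1 - c + v) (c (s (c x))) = c x := by simp [hec.idem, hvc, hv]
    have e4 := congrArg (fun y => (1 - c + v : Module.End R E) y) e1
    have e5 := congrArg (fun y => (1 - c + v : Module.End R E) y) e2
    simp only [map_add] at e4 e5
    rw [LinearMap.sub_apply, LinearMap.add_apply]
    simp only [Module.End.mul_apply]
    rw [e4, e5, e3]
    abel
  rcases he.eq_zero_or_eq c hec hcM with rfl | rfl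
  · left
    refine hsh.congr fun x => ?_
    rw [Module.End.mul_apply, ← hse x, ← hsum x]
    simp
  · right
    refine ⟨v, ?_, hcv, hvc, fun x => by rw [← hes, hv'], fun x => by rw [← hse, hv]⟩
    have := hw.sub ((Preserves.one M).sub hcM)
    simpa using this

/-! ### Indecomposable summands and their hull projections. -/

/-- Lattice form of indecomposability for a submodule. -/
def Indecomp (N : Submodule R E) : Prop :=
  N ≠ ⊥ ∧ ∀ A B : Submodule R E, Disjoint A B → A ⊔ B = N → A = ⊥ ∨ B = ⊥

/-- `e` is the projection of `E` onto an injective hull of `N` along a complement of that hull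
containing `N'`. -/
structure IsHullProj (N N' : Submodule R E) (e : Module.End R E) : Prop where
  idem : ∀ x, e (e x) = e x
  fix : ∀ x ∈ N, e x = x
  kill : ∀ x ∈ N', e x = 0
  ess : EssIn N (LinearMap.range e)

theorem exists_isHullProj [Module.Injective R E] {N N' : Submodule R E} (hd : Disjoint N N') :
    ∃ e, IsHullProj N N' e := by
  obtain ⟨e, h1, h2, h3, h4⟩ := exists_idem_of_disjoint hd
  exact ⟨e, h1, h2, h3, h4⟩

theorem IsHullProj.mem {N N' : Submodule R E} {e : Module.End R E} (h : IsHullProj N N' e)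
    {x : E} (hx : x ∈ N ⊔ N') : e x ∈ N := by
  obtain ⟨n, hn, m, hm, rfl⟩ := Submodule.mem_sup.1 hx
  rw [map_add, h.fix n hn, h.kill m hm, add_zero]
  exact hn

theorem IsHullProj.eq_zero {N N' : Submodule R E} {e f : Module.End R E} (h : IsHullProj N N' e)
    (hf : CornerIdem e f) (hN : ∀ x ∈ N, f x = 0) : f = 0 := by
  ext x
  by_contra hx
  obtain ⟨r, hr, hr0⟩ := h.ess (f x) ⟨f x, hf.left x⟩ hx
  have := hN _ hr
  rw [map_smul, hf.idem] at this
  exact hr0 this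

/-- A corner idempotent f preserving M also preserves N, so N splits as the sum of its images under
f and e - f. One image is zero, and a corner idempotent that kills N is zero because N is essential
in the range of e. -/
theorem IsHullProj.primIdem {M N N' : Submodule R E} {e : Module.End R E}
    (h : IsHullProj N N' e) (hsup : N ⊔ N' = M) (hN : Indecomp N) : PrimIdem M e where
  idem := h.idem
  ne_zero := by
    rintro rfl
    exact hN.1 ((Submodule.eq_bot_iff _).2 fun x hx => (h.fix x hx).symm)
  preserves x hx := hsup ▸ (le_sup_left : N ≤ N ⊔ N') (h.mem (hsup ▸ hx))
  eq_zero_or_eq f hf hfM := by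
    have hNM : N ≤ M := hsup ▸ le_sup_left
    have hfN : ∀ x ∈ N, f x ∈ N := fun x hx => by
      rw [← hf.left]
      exact h.mem (hsup ▸ hfM x (hNM hx))
    rcases hN.2 (N.map f) (N.map (e - f)) (by
        rw [Submodule.disjoint_def]
        rintro _ ⟨x, hx, rfl⟩ ⟨y, hy, hxy⟩
        have h1 := congrArg f hxy
        rw [hf.idem] at h1
        rw [← h1]
        simp [hf.right, hf.idem]) (by
        apply le_antisymm
        · refine sup_le ?_ ?_
          · rintro _ ⟨x, hx, rfl⟩
            exact hfN x hx
          · rintro _ ⟨x, hx, rfl⟩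
            rw [LinearMap.sub_apply, h.fix x hx]
            exact N.sub_mem hx (hfN x hx)
        · intro x hx
          refine Submodule.mem_sup.2 ⟨f x, ⟨x, hx, rfl⟩, (e - f) x, ⟨x, hx, rfl⟩, ?_⟩
          simp [h.fix x hx]) with h0 | h0
    · left
      refine h.eq_zero hf fun x hx => ?_
      exact (Submodule.eq_bot_iff _).1 h0 _ ⟨x, hx, rfl⟩
    · right
      refine (sub_eq_zero.1 (h.eq_zero (hf.sub h.idem) fun x hx => ?_)).symm
      exact (Submodule.eq_bot_iff _).1 h0 _ ⟨x, hx, rfl⟩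

/-- Every endomorphism of N extends to the corner of e. If it is not a unit, the extension has
essential kernel, and two such extensions cannot sum to the identity on N. -/
theorem isLocalRing_end [Module.Injective R E] {M N N' : Submodule R E} (hM : AutStable M)
    (hd : Disjoint N N') (hsup : N ⊔ N' = M) (hN : Indecomp N) :
    IsLocalRing (Module.End R N) := by
  obtain ⟨e, he⟩ := exists_isHullProj hd
  have hp := he.primIdem hsup hN
  have hNM : N ≤ M := hsup ▸ le_sup_left
  have hext : ∀ b : Module.End R N, ∃ s : Module.End R E, (∀ x : N, s x = b x) ∧
      (EssKer s ∨ IsUnit b) := by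
    intro b
    obtain ⟨s₀, hs₀⟩ := exists_extension N (N.subtype ∘ₗ b)
    have hs : ∀ x : N, (e * s₀ * e) x = b x := fun x => by
      simp [he.fix _ x.2, hs₀, he.fix _ (b x).2]
    have hes : ∀ x, e ((e * s₀ * e) x) = (e * s₀ * e) x := fun x => by simp [he.idem]
    have hse : ∀ x, (e * s₀ * e) (e x) = (e * s₀ * e) x := fun x => by simp [he.idem]
    refine ⟨e * s₀ * e, hs, ?_⟩
    generalize e * s₀ * e = s at hs hes hse
    rcases hp.essKer_or_inverse hM (fun x hx => by
      rw [← hse]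
      have := hs ⟨e x, he.mem (hsup ▸ hx)⟩
      exact this ▸ hNM (b _).2) hes hse with h | ⟨v, hvM, hev, hve, hsv, hvs⟩
    · exact Or.inl h
    · refine Or.inr ⟨⟨b, v.restrict (p := N) (q := N) fun x hx => ?_, ?_, ?_⟩, rfl⟩
      · rw [← hev]
        exact he.mem (hsup ▸ hvM x (hNM hx))
      · ext x
        rw [Module.End.mul_apply, ← hs, LinearMap.coe_restrict_apply, hsv, he.fix _ x.2]
        rfl
      · ext x
        rw [Module.End.mul_apply, LinearMap.coe_restrict_apply, ← hs, hvs, he.fix _ x.2]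
        rfl
  have : Nontrivial N := Submodule.nontrivial_iff_ne_bot.2 hN.1
  refine { isUnit_or_isUnit_of_add_one := fun {a b} hab => ?_ }
  obtain ⟨s, hs, hs'⟩ := hext a
  obtain ⟨t, ht, ht'⟩ := hext b
  rcases hs' with hs' | hs'
  · rcases ht' with ht' | ht'
    · obtain ⟨x, hx⟩ := exists_ne (0 : N)
      obtain ⟨r, hr, hr0⟩ := (hs'.add ht') x (by simpa using hx)
      have h1 := hs (r • x)
      have h2 := ht (r • x)
      have h3 : ((a + b) (r • x) : N) = r • x := by rw [hab]; rfl
      rw [LinearMap.add_apply] at hr0 h3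
      rw [← Submodule.coe_smul, h1, h2, ← Submodule.coe_add, h3] at hr0
      exact absurd hr0 hr
    · exact Or.inr ht'
  · exact Or.inl hs'

/-- A primitive idempotent either has a uniform range or is central modulo the endomorphisms with
essential kernel. -/
theorem PrimIdem.essKer_or_uniform [Module.Injective R E] {M : Submodule R E}
    (hM : AutStable M) {e : Module.End R E} (he : PrimIdem M e) :
    (∀ g : Module.End R E, EssKer ((1 - e) * g * e)) ∨
      ∀ X : Submodule R E, X ≤ LinearMap.range e → X ≠ ⊥ → EssIn X (LinearMap.range e) := by
  refine or_iff_not_imp_left.2 fun hne => ?_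
  push Not at hne
  obtain ⟨g₀, hg⟩ := hne
  have hge : ∀ x, ((1 - e) * g₀ * e) (e x) = ((1 - e) * g₀ * e) x := fun x => by simp [he.idem]
  have heg : ∀ x, e (((1 - e) * g₀ * e) x) = 0 := fun x => by simp [he.idem]
  generalize (1 - e) * g₀ * e = g at hg hge heg
  -- Primitivity will give `h = e`, so `g` embeds the whole range of `e` into its kernel. Then every
  -- idempotent of the corner is a product of square-zero maps, so it is `0` or `e`.
  obtain ⟨h, hh, h0, hinj⟩ := exists_cornerIdem_injective he.idem hge hg
  have hhM : Preserves M h := hM.of_injective_to_ker hh.idem hinj fun x => by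
    rw [← hh.right, heg, map_zero]
  obtain rfl := (he.eq_zero_or_eq h hh hhM).resolve_left h0
  obtain ⟨k, hk, hek, hke⟩ := exists_sq_zero_factorization he.idem hinj (fun x => heg _)
  intro X hX hX0
  obtain ⟨f, hf, hfX, hess⟩ := exists_cornerIdem he.idem (X := X) (by
    intro x hx
    obtain ⟨y, rfl⟩ := hX hx
    exact he.idem y)
  have hfM : Preserves M f := by
    have h1 : Preserves M k := hM.of_sq_zero (by intro x; rw [← hek x, hke])
    have h2 : Preserves M (g * f) := hM.of_sq_zero (by
      intro x
      rw [Module.End.mul_apply, Module.End.mul_apply, ← hf.right, heg, map_zero, map_zero])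
    have : f = k * (g * f) := LinearMap.ext fun x => by
      rw [Module.End.mul_apply, Module.End.mul_apply, ← hf.left, hk]
    rw [this]
    exact h1.mul h2
  rcases he.eq_zero_or_eq f hf hfM with rfl | rfl
  · exact absurd ((Submodule.eq_bot_iff _).2 fun x hx => (hfX x hx).symm) hX0
  · exact hess

/-! ### Complementing direct summands. -/

/-- Two disjoint direct summands with essential sum form a decomposition. -/
theorem le_sup_of_essIn [Module.Injective R E] {M K L V V' : Submodule R E} (hM : AutStable M)
    (hKL : Disjoint K L) (hKLM : K ⊔ L = M) (hVV' : Disjoint V V') (hVM : V ⊔ V' = M)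
    (hd : Disjoint K V) (hess : EssIn (K ⊔ V) ⊤) : M ≤ K ⊔ V := by
  obtain ⟨p, hp⟩ := exists_isHullProj hKL
  have hpV : Disjoint V (LinearMap.range p) := by
    rw [Submodule.disjoint_def]
    intro x hxV hxp
    by_contra hx
    obtain ⟨r, hr, hr0⟩ := hp.ess x hxp hx
    exact hr0 (Submodule.disjoint_def.1 hd _ hr (V.smul_mem r hxV))
  obtain ⟨d, hdp⟩ := exists_isHullProj hpV
  have hdp' : ∀ x, d (p x) = 0 := fun x => hdp.kill _ ⟨x, rfl⟩
  have hker : ∀ x, d x = 0 → p x = x := by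
    intro x hx
    by_contra hne
    obtain ⟨r, hr, hr0⟩ := hess (x - p x) trivial (fun h => hne (sub_eq_zero.1 h).symm)
    obtain ⟨k, hk, m, hm, hkm⟩ := Submodule.mem_sup.1 hr
    have h1 : d (k + m) = 0 := by rw [hkm, map_smul, map_sub, hx, hdp', sub_zero, smul_zero]
    rw [map_add, hdp.fix m hm, ← hp.fix k hk, hdp', zero_add] at h1
    have h2 : p (k + m) = 0 := by rw [hkm, map_smul, map_sub, hp.idem, sub_self, smul_zero]
    rw [h1, add_zero] at h2 hkm
    rw [← hkm, ← hp.fix k hk, h2] at hr0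
    exact hr0 rfl
  have hKM : K ≤ M := hKLM ▸ le_sup_left
  have hpM : ∀ x ∈ M, p x ∈ K := fun x hx => hp.mem (hKLM ▸ hx)
  -- Both `p` and `1 - d` are projections onto the range of `p`, so they differ by the square-zero
  -- map `p (1 - d) (1 - p)`.
  have hqM : Preserves M (1 - d) := by
    have h1 : Preserves M (p * (1 - d) * (1 - p)) := hM.of_sq_zero fun x => by
      simp [hp.idem]
    have h2 := (show Preserves M p from fun x hx => hKM (hpM x hx)).add h1
    convert h2 using 1
    ext x
    have h3 : p (x - d x) = x - d x := hker _ (by rw [map_sub, hdp.idem, sub_self])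
    rw [map_sub] at h3
    have h4 : p ((1 - d) (x - p x)) = x - d x - p x := by
      rw [LinearMap.sub_apply, map_sub d, hdp', sub_zero, Module.End.one_apply, map_sub, map_sub,
        hp.idem, sub_right_comm, h3]
    change x - d x = p x + p ((1 - d) (x - p x))
    rw [h4]
    abel
  intro x hx
  have h1 : (1 - d) x ∈ M := hqM x hx
  have h2 : (1 - d) x ∈ K := by
    have h3 : p ((1 - d) x) = (1 - d) x := hker _ (by simp [hdp.idem])
    rw [← h3]
    exact hpM _ h1
  have h3 : d x ∈ M := by simpa using M.sub_mem hx h1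
  -- The V'-component of `d x` lies in the range of `d`, where V is essential, and V' is disjoint
  -- from V.
  have h4 : d x ∈ V := by
    obtain ⟨m, hm, m', hm', hmm⟩ := Submodule.mem_sup.1 (hVM ▸ h3)
    have h5 : d m' = m' := by
      have := congrArg d hmm
      rw [map_add, hdp.idem, ← hmm, hdp.fix m hm] at this
      exact add_left_cancel this
    by_cases h6 : m' = 0
    · rw [← hmm, h6, add_zero]
      exact hm
    · obtain ⟨r, hr, hr0⟩ := hdp.ess m' ⟨m', h5⟩ h6
      exact absurd (Submodule.disjoint_def.1 hVV' _ hr (V'.smul_mem r hm')) hr0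
  refine Submodule.mem_sup.2 ⟨_, h2, _, h4, ?_⟩
  simp

theorem essIn_iSup {ι : Type*} {N : ι → Submodule R E} (hind : iSupIndep N)
    {W : Submodule R E} (hW : ∀ i, EssIn W (N i)) : EssIn W (⨆ i, N i) := by
  classical
  have key : ∀ F : Finset ι, EssIn W (⨆ i ∈ F, N i) := by
    intro F
    induction F using Finset.induction_on with
    | empty =>
      intro y hy hy0
      simp only [Finset.notMem_empty, iSup_false, iSup_bot, Submodule.mem_bot] at hy
      exact absurd hy hy0
    | insert a F ha ih =>
      intro y hy hy0
      rw [Finset.iSup_insert] at hy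
      have hdis : Disjoint (N a) (⨆ i ∈ F, N i) :=
        hind.disjoint_biSup (y := (F : Set ι)) ha
      obtain ⟨m, hm, z, hz, rfl⟩ := Submodule.mem_sup.1 hy
      by_cases hm0 : m = 0
      · subst hm0
        rw [zero_add] at hy0 ⊢
        exact ih z hz hy0
      obtain ⟨r, hr, hr0⟩ := hW a m hm hm0
      by_cases hz0 : r • z = 0
      · exact ⟨r, by rwa [smul_add, hz0, add_zero], by rwa [smul_add, hz0, add_zero]⟩
      obtain ⟨q, hq, hq0⟩ := ih _ (Submodule.smul_mem _ r hz) hz0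
      refine ⟨q * r, ?_, fun h => hq0 ?_⟩
      · rw [mul_smul, smul_add, smul_add]
        exact W.add_mem (W.smul_mem q hr) hq
      · rw [mul_smul, smul_add, smul_add] at h
        refine Submodule.disjoint_def.1 hdis _ ?_ (Submodule.smul_mem _ _ (Submodule.smul_mem _ _ hz))
        rw [eq_neg_of_add_eq_zero_right h]
        exact neg_mem (Submodule.smul_mem _ _ (Submodule.smul_mem _ _ hm))
  intro y hy
  obtain ⟨F, hF⟩ := Submodule.mem_iSup_iff_exists_finset.1 hy
  exact key F y hF

theorem EssIn.trans {X Y Z : Submodule R E} (h : EssIn X Y) (h' : EssIn Y Z) : EssIn X Z := by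
  intro z hz hz0
  obtain ⟨r, hr, hr0⟩ := h' z hz hz0
  obtain ⟨q, hq, hq0⟩ := h _ hr hr0
  exact ⟨q * r, by rwa [mul_smul], by rwa [mul_smul]⟩

theorem exists_maximal_iSup_disjoint {ι : Type*} (N : ι → Submodule R E) (K : Submodule R E) :
    ∃ s : Set ι, Maximal (fun s : Set ι => Disjoint K (⨆ i ∈ s, N i)) s := by
  refine zorn_subset {s : Set ι | Disjoint K (⨆ i ∈ s, N i)} fun c hc hchain =>
    ⟨⋃₀ c, ?_, fun s hs => Set.subset_sUnion_of_mem hs⟩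
  rw [Set.mem_ofPred_eq, iSup_sUnion, ← sSup_image]
  refine ((hchain.image_of_map_rel (· ⊆ ·) (· ≤ ·) _ fun s t hst =>
    biSup_mono fun i hi => hst hi).directedOn.disjoint_sSup_right).2 ?_
  rintro _ ⟨s, hs, rfl⟩
  exact hc hs

theorem exists_complement [Module.Injective R E] {M K L : Submodule R E} (hM : AutStable M)
    (hME : EssIn M ⊤) {ι : Type*} {N : ι → Submodule R E} (hind : iSupIndep N)
    (hsup : ⨆ i, N i = M) (hN : ∀ i, Indecomp (N i)) (hKL : Disjoint K L) (hKLM : K ⊔ L = M) :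
    ∃ s : Set ι, Disjoint K (⨆ i ∈ s, N i) ∧ K ⊔ ⨆ i ∈ s, N i = M := by
  obtain ⟨s, hs⟩ := exists_maximal_iSup_disjoint N K
  have hsd : Disjoint K (⨆ i ∈ s, N i) := hs.prop
  have hsplit : ∀ t : Set ι, (⨆ i ∈ t, N i) ⊔ ⨆ i ∈ tᶜ, N i = M := fun t => by
    rw [← iSup_union, Set.union_compl_self, iSup_univ, hsup]
  have hdisj : ∀ t : Set ι, Disjoint (⨆ i ∈ t, N i) (⨆ i ∈ tᶜ, N i) := fun t =>
    hind.disjoint_biSup_biSup disjoint_compl_right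
  obtain ⟨p, hp⟩ := exists_isHullProj hKL
  obtain ⟨q, hq⟩ := exists_isHullProj hsd.symm
  have hKM : K ≤ M := hKLM ▸ le_sup_left
  have hess : ∀ i, EssIn (K ⊔ ⨆ i ∈ s, N i) (N i) := by
    intro i
    by_cases his : i ∈ s
    · exact fun y hy hy0 => ⟨1, by
        rw [one_smul]
        exact (le_sup_right : _ ≤ K ⊔ ⨆ i ∈ s, N i) ((le_biSup N his) hy), by rwa [one_smul]⟩
    obtain ⟨e, he⟩ := exists_isHullProj (hind i)
    have hNi : N i ⊔ ⨆ j, ⨆ (_ : j ≠ i), N j = M := by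
      have := hsplit {i}
      simpa using this
    have hprim := he.primIdem hNi (hN i)
    have hVker : ∀ m ∈ ⨆ j ∈ s, N j, e m = 0 := fun m hm => he.kill m
      ((biSup_mono fun j hj h => his (h ▸ hj) : (⨆ j ∈ s, N j) ≤ ⨆ j, ⨆ (_ : j ≠ i), N j) hm)
    have hNrange : N i ≤ LinearMap.range e := fun x hx => ⟨x, he.fix x hx⟩
    obtain ⟨n, hn, k, hk, m, hm, hnkm, hn0⟩ : ∃ n ∈ N i, ∃ k ∈ K, ∃ m ∈ ⨆ j ∈ s, N j,
        n + m = k ∧ n ≠ 0 := by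
      have hnot : ¬ Disjoint K (⨆ j ∈ insert i s, N j) := fun h =>
        his (hs.2 h (Set.subset_insert i s) (Set.mem_insert i s))
      rw [iSup_insert, Submodule.disjoint_def] at hnot
      push Not at hnot
      obtain ⟨k, hk, hk', hk0⟩ := hnot
      obtain ⟨n, hn, m, hm, rfl⟩ := Submodule.mem_sup.1 hk'
      refine ⟨n, hn, _, hk, m, hm, rfl, ?_⟩
      rintro rfl
      rw [zero_add] at hk hk0
      exact hk0 (Submodule.disjoint_def.1 hsd _ hk hm)
    rcases hprim.essKer_or_uniform hM with hU | hU
    -- Since `q n = -m` is killed by `e`, essentiality of the kernel of `(1 - e) q e` gives a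
    -- multiple of `n + m = k` in which `m` disappears but `n` does not.
    · have hKn : ∃ x ∈ N i, x ∈ K ∧ x ≠ 0 := by
        obtain ⟨r, hr, hr0⟩ := hU q n hn0
        have h1 : q n = -m := by
          have := congrArg q hnkm
          rw [map_add, hq.fix m hm, hq.kill k hk] at this
          exact eq_neg_of_add_eq_zero_left this
        have h2 : r • m = 0 := by
          rw [map_smul] at hr0
          simpa [he.fix n hn, h1, hVker m hm] using hr0
        refine ⟨r • n, Submodule.smul_mem _ r hn, ?_, hr⟩
        have : r • n = r • k := by rw [← hnkm, smul_add, h2, add_zero]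
        rw [this]
        exact K.smul_mem r hk
      obtain ⟨x, hxN, hxK, hx0⟩ := hKn
      have hpM : Preserves M p := fun x hx => hKM (hp.mem (hKLM ▸ hx))
      rcases hprim.essKer_or_inverse hM (s := e * p * e)
          ((hprim.preserves.mul hpM).mul hprim.preserves) (fun y => by simp [he.idem])
          (fun y => by simp [he.idem]) with hJ | ⟨v, -, -, hve, -, hvs⟩
      · obtain ⟨r, hr, hr0⟩ := hJ x hx0
        rw [map_smul] at hr0
        simp only [Module.End.mul_apply, he.fix x hxN, hp.fix x hxK] at hr0
        exact absurd hr0 hr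
      -- For `z = (1 - p) e y`, `p z = 0` and `v e p e z = e z` give `e z = -v e p (z - e z)`. Thus
      -- `z` is determined by `(1 - e) z`, which depends on `y` through a map with essential kernel.
      · have hJ : EssKer ((1 - p) * e) := by
          have h1 := (hU (1 - p)).mul_left (-(v * e * p))
          refine ((hU (1 - p)).add h1).congr fun y => ?_
          change e y - p (e y) - e (e y - p (e y)) +
            -(v (e (p (e y - p (e y) - e (e y - p (e y)))))) = e y - p (e y)
          have h3 : p (e y - p (e y)) = 0 := by rw [map_sub, hp.idem, sub_self]
          have h4 : v (e (p (e (e y - p (e y))))) = e (e y - p (e y)) := by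
            have := hvs (e y - p (e y))
            rwa [Module.End.mul_apply, Module.End.mul_apply] at this
          generalize e y - p (e y) = z at h3 h4
          rw [map_sub p, h3, zero_sub, map_neg, map_neg, h4, neg_neg, sub_add_cancel]
        intro y hy hy0
        obtain ⟨r, hr, hr0⟩ := hJ y hy0
        have hry : r • y ∈ N i := Submodule.smul_mem _ r hy
        rw [Module.End.mul_apply, he.fix _ hry, LinearMap.sub_apply, sub_eq_zero] at hr0
        refine ⟨r, le_sup_left (α := Submodule R E) ?_, hr⟩
        rw [show r • y = p (r • y) from hr0]
        exact hp.mem (hKLM ▸ (hNi ▸ (le_sup_left : N i ≤ _)) hry)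
    · intro y hy hy0
      obtain ⟨r, hr, hr0⟩ := hU (N i ⊓ (K ⊔ ⨆ i ∈ s, N i)) (inf_le_left.trans hNrange) (by
        intro h
        refine hn0 ((Submodule.eq_bot_iff _).1 h n ⟨hn, Submodule.mem_sup.2
          ⟨k, hk, -m, neg_mem hm, ?_⟩⟩)
        rw [← hnkm, add_neg_cancel_right]) y (hNrange hy) hy0
      exact ⟨r, hr.2, hr0⟩
  have hW : EssIn (K ⊔ ⨆ i ∈ s, N i) ⊤ := (essIn_iSup hind hess).trans (hsup ▸ hME)
  refine ⟨s, hsd, le_antisymm (sup_le hKM ?_)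
    (le_sup_of_essIn hM hKL hKLM (hdisj s) (hsplit s) hsd hW)⟩
  exact hsplit s ▸ le_sup_left

end Ambient

/-! ### Transfer from the hull back to the module. -/

theorem isLocalRing_of_ringEquiv {A B : Type*} [Ring A] [Ring B] [IsLocalRing A] (e : A ≃+* B) :
    IsLocalRing B :=
  have : Nontrivial B := e.symm.toEquiv.nontrivial
  { isUnit_or_isUnit_of_add_one := fun {a b} h => by
      rw [← MulEquiv.isUnit_map e.symm, ← MulEquiv.isUnit_map e.symm (x := b)]
      exact IsLocalRing.isUnit_or_isUnit_of_add_one (by rw [← map_add, h, map_one]) }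

theorem indecomp_map {R : Type u} [Ring R] {M : Type v} [AddCommGroup M] [Module R M]
    {E : Type w} [AddCommGroup E] [Module R E] {f : M →ₗ[R] E} (hf : Function.Injective f)
    {N : Submodule R M} (hN : IsIndecomposableModule R N) : Indecomp (N.map f) := by
  have hnt := hN.nontrivial
  have hN0 : N ≠ ⊥ := Submodule.nontrivial_iff_ne_bot.1 hnt
  refine ⟨fun h => hN0 ?_, fun A B hd hAB => ?_⟩
  · exact Submodule.map_injective_of_injective hf (by rw [h, Submodule.map_bot])
  have hA : ∀ a ∈ A, ∃ n : N, f n = a := fun a ha => by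
    obtain ⟨n, hn, rfl⟩ := hAB ▸ (le_sup_left : A ≤ A ⊔ B) ha
    exact ⟨⟨n, hn⟩, rfl⟩
  have hB : ∀ b ∈ B, ∃ n : N, f n = b := fun b hb => by
    obtain ⟨n, hn, rfl⟩ := hAB ▸ (le_sup_right : B ≤ A ⊔ B) hb
    exact ⟨⟨n, hn⟩, rfl⟩
  have hinj : ∀ n : N, f n = 0 → n = 0 := fun n hn =>
    Subtype.ext (hf (by simpa using hn))
  have hcompl : IsCompl (A.comap (f ∘ₗ N.subtype)) (B.comap (f ∘ₗ N.subtype)) := by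
    constructor
    · rw [Submodule.disjoint_def]
      exact fun n hnA hnB => hinj n (Submodule.disjoint_def.1 hd _ hnA hnB)
    · rw [codisjoint_iff, Submodule.eq_top_iff']
      intro n
      obtain ⟨a, ha, b, hb, hab⟩ := Submodule.mem_sup.1
        (hAB.symm ▸ Submodule.mem_map_of_mem n.2 : f n ∈ A ⊔ B)
      obtain ⟨x, rfl⟩ := hA a ha
      obtain ⟨y, rfl⟩ := hB b hb
      refine Submodule.mem_sup.2 ⟨x, ha, y, hb, Subtype.ext (hf ?_)⟩
      rw [← hab, Submodule.coe_add, map_add]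
  rcases hN.eq_bot_or_eq_top _ ⟨_, hcompl⟩ with h | h
  · left
    rw [Submodule.eq_bot_iff]
    intro a ha
    obtain ⟨n, rfl⟩ := hA a ha
    rw [(Submodule.eq_bot_iff _).1 h n ha]
    simp
  · right
    rw [Submodule.eq_bot_iff]
    intro b hb
    obtain ⟨n, rfl⟩ := hB b hb
    exact Submodule.disjoint_def.1 hd _ ((Submodule.eq_top_iff'.1 h) n) hb

theorem iSupIndep_map {R : Type u} [Ring R] {M : Type v} [AddCommGroup M] [Module R M]
    {ι : Type*} {N : ι → Submodule R M} {E : Type w} [AddCommGroup E] [Module R E] {f : M →ₗ[R] E}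
    (hf : Function.Injective f) (hN : iSupIndep N) : iSupIndep fun i => (N i).map f := by
  intro i
  simp only [← Submodule.map_iSup]
  exact Submodule.disjoint_map hf (hN i)

section Transfer

variable {R : Type u} [Ring R] {M : Type v} [AddCommGroup M] [Module R M]
  {ι : Type*} [DecidableEq ι] {N : ι → Submodule R M}

theorem exists_autStable_range (hM : IsAutomorphismInvariant R M) :
    ∃ (E : Type (max u v)) (_ : AddCommGroup E) (_ : Module R E) (_ : Module.Injective R E)
      (f : M →ₗ[R] E), Function.Injective f ∧ EssIn (LinearMap.range f) ⊤ ∧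
        AutStable (LinearMap.range f) := by
  obtain ⟨E, _, _, f, hf, hinv⟩ := hM
  refine ⟨E, _, _, hf.injective_module, f, hf.injective_map,
    essIn_of_disjoint fun Z _ hZ => hf.essential Z ?_, fun φ x hx => ?_⟩
  · rw [inf_comm]
    exact hZ.eq_bot
  · exact hinv φ ⟨x, hx, rfl⟩

theorem isLocalRing_end_of_decomposition (hM : IsAutomorphismInvariant R M)
    (hN : IsIndecomposableDecomposition N) (i : ι) : IsLocalRing (Module.End R (N i)) := by
  obtain ⟨E, _, _, _, f, hf, -, hst⟩ := exists_autStable_range hM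
  obtain ⟨hind, hsup⟩ :=
    (DirectSum.isInternal_submodule_iff_iSupIndep_and_iSup_eq_top N).1 hN.isInternal
  have hc : N i ⊔ ⨆ j, ⨆ (_ : j ≠ i), N j = ⊤ := by
    rw [eq_top_iff, ← hsup]
    refine iSup_le fun j => ?_
    by_cases hj : j = i
    · exact hj ▸ le_sup_left
    · exact (le_biSup N hj).trans le_sup_right
  have hloc := isLocalRing_end hst (N := (N i).map f)
    (N' := (⨆ j, ⨆ (_ : j ≠ i), N j).map f) (Submodule.disjoint_map hf (hind i))
    (by rw [← Submodule.map_sup, hc, Submodule.map_top])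
    (indecomp_map hf (hN.indecomposable i))
  exact isLocalRing_of_ringEquiv (Submodule.equivMapOfInjective f hf (N i)).conjRingEquiv.symm

theorem complementsDirectSummands_of_decomposition (hM : IsAutomorphismInvariant R M)
    (hN : IsIndecomposableDecomposition N) : ComplementsDirectSummands N := by
  obtain ⟨E, _, _, _, f, hf, hess, hst⟩ := exists_autStable_range hM
  rintro K ⟨L, hKL⟩
  obtain ⟨hind, hsup⟩ :=
    (DirectSum.isInternal_submodule_iff_iSupIndep_and_iSup_eq_top N).1 hN.isInternal
  obtain ⟨s, hs, hs'⟩ := exists_complement hst hess (iSupIndep_map hf hind)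
    (by rw [← Submodule.map_iSup, hsup, Submodule.map_top])
    (fun i => indecomp_map hf (hN.indecomposable i)) (Submodule.disjoint_map hf hKL.disjoint)
    (by rw [← Submodule.map_sup, hKL.sup_eq_top, Submodule.map_top])
  simp only [← Submodule.map_iSup] at hs hs'
  refine ⟨s, ?_, ?_⟩
  · rw [Submodule.disjoint_def]
    intro x hxK hxV
    exact hf (by simpa using Submodule.disjoint_def.1 hs (f x) ⟨x, hxK, rfl⟩ ⟨x, hxV, rfl⟩)
  · rw [codisjoint_iff]
    refine Submodule.map_injective_of_injective hf ?_
    rw [Submodule.map_sup, hs', Submodule.map_top]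

end Transfer

/-! ### Azumaya's uniqueness theorem via residue division rings. -/

theorem isUnit_of_mul_eq_one_of_isLocalRing {S : Type*} [Ring S] [IsLocalRing S] {a b : S}
    (h : a * b = 1) : IsUnit a ∧ IsUnit b := by
  have hidem : b * a * (b * a) = b * a := by
    rw [mul_assoc, ← mul_assoc a, h, one_mul]
  have hba : b * a = 1 := by
    rcases IsLocalRing.isUnit_or_isUnit_of_add_one (add_sub_cancel (b * a) 1) with hu | hu
    · exact hu.mul_left_cancel (by rw [hidem, mul_one])
    · have h0 : b * a = 0 := hu.mul_left_cancel (by rw [sub_mul, hidem]; simp)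
      have : (1 : S) = 0 := by
        calc (1 : S) = a * (b * a) * b := by rw [← mul_assoc a, h, one_mul, h]
          _ = 0 := by rw [h0, mul_zero, zero_mul]
      exact absurd this one_ne_zero
  exact ⟨⟨⟨a, b, h, hba⟩, rfl⟩, ⟨⟨b, a, hba, h⟩, rfl⟩⟩

theorem isUnit_of_isUnit_mul {S : Type*} [Ring S] [IsLocalRing S] {a b : S}
    (h : IsUnit (a * b)) : IsUnit a ∧ IsUnit b := by
  obtain ⟨u, hu⟩ := h
  refine ⟨(isUnit_of_mul_eq_one_of_isLocalRing (b := b * ↑u⁻¹) ?_).1,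
    (isUnit_of_mul_eq_one_of_isLocalRing (a := ↑u⁻¹ * a) ?_).2⟩
  · rw [← mul_assoc, ← hu, Units.mul_inv]
  · rw [mul_assoc, ← hu, Units.inv_mul]

/-- The residue division ring of a (noncommutative) local ring. -/
theorem exists_residue (S : Type u) [Ring S] [IsLocalRing S] :
    ∃ (D : Type u) (_ : DivisionRing D) (θ : S →+* D), ∀ x, θ x = 0 ↔ ¬ IsUnit x := by
  let I : Ideal S :=
    { carrier := nonunits S
      zero_mem' := not_isUnit_zero
      add_mem' := IsLocalRing.nonunits_add
      smul_mem' := fun _ _ hx hu => hx (isUnit_of_isUnit_mul hu).2 }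
  have : I.IsTwoSided := ⟨fun _ hx hu => hx (isUnit_of_isUnit_mul hu).1⟩
  have hI : ∀ x, Ideal.Quotient.mk I x = 0 ↔ ¬ IsUnit x := fun x =>
    Ideal.Quotient.eq_zero_iff_mem
  have : Nontrivial (S ⧸ I) := ⟨⟨Ideal.Quotient.mk I 1, 0, fun h => (hI 1).1 h isUnit_one⟩⟩
  refine ⟨S ⧸ I, DivisionRing.ofIsUnitOrEqZero fun a => ?_, Ideal.Quotient.mk I, hI⟩
  obtain ⟨x, rfl⟩ := Ideal.Quotient.mk_surjective a
  by_cases hx : IsUnit x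
  · exact Or.inl (hx.map _)
  · exact Or.inr ((hI x).2 hx)

section

variable {R : Type u} [Ring R] {M : Type v} [AddCommGroup M] [Module R M]

/-- The projections of an internal direct sum. -/
theorem exists_projections {ι : Type*} [DecidableEq ι] {N : ι → Submodule R M}
    (hN : DirectSum.IsInternal N) :
    ∃ π : ∀ i, M →ₗ[R] N i, (∀ i (x : N i), π i x = x) ∧
      (∀ i j, i ≠ j → ∀ x : N i, π j x = 0) ∧
      ∀ x, ∃ F : Finset ι, (∀ i ∉ F, π i x = 0) ∧ ∑ i ∈ F, (π i x : M) = x := by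
  classical
  let φ := LinearEquiv.ofBijective (DirectSum.coeLinearMap N) hN
  refine ⟨fun i => DirectSum.component R ι (fun i => N i) i ∘ₗ φ.symm.toLinearMap,
    fun i x => hN.ofBijective_coeLinearMap_same x,
    fun i j hij x => hN.ofBijective_coeLinearMap_of_ne hij x, fun x => ?_⟩
  refine ⟨DFinsupp.support (φ.symm x), fun i hi => DFinsupp.notMem_support_iff.1 hi, ?_⟩
  have h1 : φ (φ.symm x) = x := φ.apply_symm_apply x
  conv_rhs => rw [← h1]
  exact (DirectSum.coeLinearMap_eq_dfinsuppSum N (φ.symm x)).symm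

/-- An endomorphism with local endomorphism ring that factors through an indecomposable module
not isomorphic to it is not invertible. -/
theorem not_isUnit_of_factor {A B : Type*} [AddCommGroup A] [Module R A] [Nontrivial A]
    [AddCommGroup B] [Module R B] (hB : IsIndecomposableModule R B) (hAB : IsEmpty (A ≃ₗ[R] B))
    (f : A →ₗ[R] B) (g : B →ₗ[R] A) : ¬ IsUnit (g ∘ₗ f : Module.End R A) := by
  rintro ⟨u, hu⟩
  have hinv : ∀ x, (↑u⁻¹ : Module.End R A) (g (f x)) = x := fun x => by
    have h1 : (↑u⁻¹ * ↑u : Module.End R A) x = x := by rw [Units.inv_mul]; rfl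
    rwa [hu] at h1
  let e : Module.End R B := f ∘ₗ (↑u⁻¹ : Module.End R A) ∘ₗ g
  have he : IsIdempotentElem e := LinearMap.ext fun x => congrArg f (hinv _)
  have hef : ∀ x, e (f x) = f x := fun x => congrArg f (hinv x)
  have hfinj : Function.Injective f := fun x y hxy => by rw [← hinv x, hxy, hinv]
  rcases hB.eq_bot_or_eq_top _ ⟨_, LinearMap.IsIdempotentElem.isCompl he⟩ with h | h
  · obtain ⟨x, hx⟩ := exists_ne (0 : A)
    have h1 : f x ∈ LinearMap.range e := ⟨f x, hef x⟩
    rw [h, Submodule.mem_bot] at h1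
    exact hx (hfinj (by rw [h1, map_zero]))
  · refine hAB.false (LinearEquiv.ofBijective f ⟨hfinj, fun y => ?_⟩)
    obtain ⟨z, rfl⟩ := (h.symm ▸ Submodule.mem_top : y ∈ LinearMap.range e)
    exact ⟨_, rfl⟩

/-- Expansion of the residue of an endomorphism of `A` factoring through a direct sum of
indecomposable modules, in terms of the summands isomorphic to `A`. -/
theorem exists_residue_expansion {A : Type*} [AddCommGroup A] [Module R A] [Nontrivial A]
    {D : Type*} [DivisionRing D] {θ : (Module.End R A)ᵐᵒᵖ →+* D}
    (hθ : ∀ x, θ x = 0 ↔ ¬ IsUnit x) {ι : Type*} [DecidableEq ι] {N : ι → Submodule R M}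
    (hN : IsIndecomposableDecomposition N) :
    ∃ (p : {i // Nonempty (A ≃ₗ[R] N i)} → M →ₗ[R] A)
      (q : {i // Nonempty (A ≃ₗ[R] N i)} → A →ₗ[R] M),
      (∀ i j, p i ∘ₗ q j = if i = j then LinearMap.id else 0) ∧
      ∀ f : A →ₗ[R] M, ∃ c : {i // Nonempty (A ≃ₗ[R] N i)} →₀ D,
        (∀ i, c i = θ (MulOpposite.op (p i ∘ₗ f))) ∧
        ∀ g : M →ₗ[R] A, θ (MulOpposite.op (g ∘ₗ f)) =
          c.sum fun i d => d * θ (MulOpposite.op (g ∘ₗ q i)) := by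
  classical
  obtain ⟨π, hπ, hπ', hfin⟩ := exists_projections hN.isInternal
  have hker : ∀ (h : Module.End R A) (a : A), a ≠ 0 → h a = 0 → θ (MulOpposite.op h) = 0 := by
    intro h a ha h0
    rw [hθ, isUnit_op]
    rintro ⟨u, rfl⟩
    have h1 : (↑u⁻¹ * ↑u : Module.End R A) a = a := by rw [Units.inv_mul]; rfl
    rw [Module.End.mul_apply, h0, map_zero] at h1
    exact ha h1.symm
  let α : ∀ i : {i // Nonempty (A ≃ₗ[R] N i)}, A ≃ₗ[R] N i := fun i => i.2.some
  let p : {i // Nonempty (A ≃ₗ[R] N i)} → M →ₗ[R] A := fun i => (α i).symm.toLinearMap ∘ₗ π i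
  let q : {i // Nonempty (A ≃ₗ[R] N i)} → A →ₗ[R] M := fun i =>
    (N i).subtype ∘ₗ (α i).toLinearMap
  refine ⟨p, q, fun i j => ?_, fun f => ?_⟩
  · ext x
    by_cases hij : i = j
    · subst hij
      simp [p, q, hπ]
    · have := hπ' j i (fun h => hij (Subtype.ext h.symm)) (α j x)
      simp [p, q, hij, this]
  -- One nonzero vector suffices: an endomorphism killing `a` has residue zero. So only the finitely
  -- many components of `f a` matter, even if the image of `f` meets infinitely many summands.
  · obtain ⟨a, ha⟩ := exists_ne (0 : A)
    obtain ⟨F, hF, hsum⟩ := hfin (f a)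
    have hp0 : ∀ i, i.1 ∉ F → θ (MulOpposite.op (p i ∘ₗ f)) = 0 := fun i hi =>
      hker _ a ha (by simp [p, hF _ hi])
    let c : {i // Nonempty (A ≃ₗ[R] N i)} →₀ D :=
      Finsupp.onFinset (F.subtype _) (fun i => θ (MulOpposite.op (p i ∘ₗ f))) fun i hi => by
        by_contra h
        exact hi (hp0 i (by simpa using h))
    refine ⟨c, fun i => rfl, fun g => ?_⟩
    have h1 : θ (MulOpposite.op (g ∘ₗ f)) =
        ∑ i ∈ F, θ (MulOpposite.op (g ∘ₗ (N i).subtype ∘ₗ π i ∘ₗ f)) := by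
      rw [← map_sum, ← sub_eq_zero, ← map_sub, ← Finset.op_sum, ← MulOpposite.op_sub]
      refine hker _ a ha ?_
      rw [LinearMap.sub_apply, LinearMap.sum_apply, sub_eq_zero]
      conv_lhs => rw [LinearMap.comp_apply, ← hsum, map_sum]
      rfl
    rw [h1, Finsupp.onFinset_sum _ (by simp)]
    rw [← Finset.sum_filter_add_sum_filter_not F (fun i => Nonempty (A ≃ₗ[R] N i)),
      Finset.sum_eq_zero (s := F.filter fun i => ¬ Nonempty (A ≃ₗ[R] N i)), add_zero,
      ← Finset.sum_subtype_eq_sum_filter]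
    · refine Finset.sum_congr rfl fun i _ => ?_
      rw [← map_mul, ← MulOpposite.op_mul]
      congr 2
      ext x
      simp [p, q]
    · intro i hi
      rw [hθ, isUnit_op]
      exact not_isUnit_of_factor (hN.indecomposable i)
        (not_nonempty_iff.1 (Finset.mem_filter.1 hi).2) (π i ∘ₗ f) (g ∘ₗ (N i).subtype)

/-- The (i, j) entry of the composite is the expansion of the residue of `p j ∘ₗ q i` through the
other decomposition, so it is a Kronecker delta. -/
theorem linearCombination_comp_eq_id {A : Type*} [AddCommGroup A] [Module R A]
    {D : Type*} [DivisionRing D] {θ : (Module.End R A)ᵐᵒᵖ →+* D} {ι κ : Type*} [DecidableEq ι]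
    {p : ι → M →ₗ[R] A} {q : ι → A →ₗ[R] M} {q' : κ → A →ₗ[R] M}
    (hpq : ∀ i j, p i ∘ₗ q j = if i = j then LinearMap.id else 0)
    {c : (A →ₗ[R] M) → ι →₀ D} (hc : ∀ f i, c f i = θ (MulOpposite.op (p i ∘ₗ f)))
    {c' : (A →ₗ[R] M) → κ →₀ D} (hc' : ∀ f (g : M →ₗ[R] A), θ (MulOpposite.op (g ∘ₗ f)) =
      (c' f).sum fun k d => d * θ (MulOpposite.op (g ∘ₗ q' k))) :
    (Finsupp.linearCombination D fun k => c (q' k)) ∘ₗ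
      (Finsupp.linearCombination D fun i => c' (q i)) = LinearMap.id := by
  refine Finsupp.lhom_ext' fun i => LinearMap.ext_ring (Finsupp.ext fun j => ?_)
  have h1 := hc' (q i) (p j)
  rw [hpq] at h1
  simp only [LinearMap.comp_apply, Finsupp.lsingle_apply, Finsupp.linearCombination_single,
    one_smul, LinearMap.id_apply]
  rw [Finsupp.linearCombination_apply, Finsupp.sum_apply]
  simp only [Finsupp.smul_apply, smul_eq_mul, hc]
  rw [← h1, Finsupp.single_apply]
  by_cases hij : j = i
  · rw [if_pos hij, if_pos hij.symm]
    exact map_one θ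
  · rw [if_neg hij, if_neg (Ne.symm hij), MulOpposite.op_zero, map_zero]

/-- The number of summands isomorphic to a module with local endomorphism ring is the same in any
two indecomposable decompositions. -/
theorem nonempty_equiv_of_isLocalRing {A : Type*} [AddCommGroup A] [Module R A] [Nontrivial A]
    [IsLocalRing (Module.End R A)] {ι : Type*} [DecidableEq ι] {N : ι → Submodule R M}
    (hN : IsIndecomposableDecomposition N) {κ : Type*} [DecidableEq κ] {N' : κ → Submodule R M}
    (hN' : IsIndecomposableDecomposition N') :
    Nonempty ({i // Nonempty (A ≃ₗ[R] N i)} ≃ {k // Nonempty (A ≃ₗ[R] N' k)}) := by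
  classical
  -- Passing to the opposite ring puts the coefficient coming from `p i ∘ₗ f` on the left, as left
  -- linear combinations require.
  have : IsLocalRing (Module.End R A)ᵐᵒᵖ :=
    { isUnit_or_isUnit_of_add_one := fun {a b} h => by
        rw [← isUnit_unop, ← isUnit_unop]
        exact IsLocalRing.isUnit_or_isUnit_of_add_one (congrArg MulOpposite.unop h) }
  obtain ⟨D, _, θ, hθ⟩ := exists_residue (Module.End R A)ᵐᵒᵖ
  obtain ⟨p, q, hpq, hc⟩ := exists_residue_expansion hθ hN
  obtain ⟨p', q', hpq', hc'⟩ := exists_residue_expansion hθ hN'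
  choose c hc hcs using hc
  choose c' hc' hcs' using hc'
  let Φ := Finsupp.linearCombination D fun i => c' (q i)
  let Ψ := Finsupp.linearCombination D fun k => c (q' k)
  have hΨΦ : Ψ ∘ₗ Φ = LinearMap.id := linearCombination_comp_eq_id hpq hc hcs'
  have hΦΨ : Φ ∘ₗ Ψ = LinearMap.id := linearCombination_comp_eq_id hpq' hc' hcs
  exact ⟨(Module.Basis.ofRepr (LinearEquiv.refl D _)).indexEquiv
    (Module.Basis.ofRepr (LinearEquiv.ofLinearMap Φ Ψ hΦΨ hΨΦ))⟩

end

/-- Krull–Remak–Schmidt–Azumaya: indecomposable decompositions with local endomorphism rings are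
unique up to isomorphism and permutation of the summands. -/
theorem exists_equiv_of_isLocalRing {R : Type u} [Ring R] {M : Type v} [AddCommGroup M]
    [Module R M] {ι : Type*} [DecidableEq ι] {N : ι → Submodule R M}
    (hN : IsIndecomposableDecomposition N) (hloc : ∀ i, IsLocalRing (Module.End R (N i)))
    {κ : Type*} [DecidableEq κ] {N' : κ → Submodule R M}
    (hN' : IsIndecomposableDecomposition N') (hloc' : ∀ k, IsLocalRing (Module.End R (N' k))) :
    ∃ σ : ι ≃ κ, ∀ i, Nonempty (N i ≃ₗ[R] N' (σ i)) := by
  classical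
  -- Both index sets are partitioned by isomorphism class; bijections between corresponding classes
  -- are then glued.
  let r : Setoid (Submodule R M) :=
    { r := fun X Y => Nonempty (X ≃ₗ[R] Y)
      iseqv := ⟨fun X => ⟨LinearEquiv.refl R X⟩, fun ⟨e⟩ => ⟨e.symm⟩,
        fun ⟨e⟩ ⟨e'⟩ => ⟨e.trans e'⟩⟩ }
  have hmk : ∀ X Y : Submodule R M, Nonempty (X ≃ₗ[R] Y) ↔
      (Quotient.mk r Y) = Quotient.mk r X := fun X Y => by
    rw [eq_comm]
    exact (Quotient.eq (r := r)).symm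
  have key : ∀ X : Submodule R M, Nontrivial X → IsLocalRing (Module.End R X) →
      Nonempty ({i // Quotient.mk r (N i) = Quotient.mk r X} ≃
        {k // Quotient.mk r (N' k) = Quotient.mk r X}) := by
    intro X _ _
    obtain ⟨e⟩ := nonempty_equiv_of_isLocalRing (A := X) hN hN'
    exact ⟨(Equiv.subtypeEquivRight fun i => (hmk X (N i)).symm).trans
      (e.trans (Equiv.subtypeEquivRight fun k => hmk X (N' k)))⟩
  have fiber : ∀ c : Quotient r, Nonempty ({i // Quotient.mk r (N i) = c} ≃
      {k // Quotient.mk r (N' k) = c}) := by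
    intro c
    by_cases h : ∃ i, Quotient.mk r (N i) = c
    · obtain ⟨i, rfl⟩ := h
      exact key (N i) (hN.indecomposable i).nontrivial (hloc i)
    by_cases h' : ∃ k, Quotient.mk r (N' k) = c
    · obtain ⟨k, rfl⟩ := h'
      exact key (N' k) (hN'.indecomposable k).nontrivial (hloc' k)
    have : IsEmpty {i // Quotient.mk r (N i) = c} := ⟨fun i => h ⟨i, i.2⟩⟩
    have : IsEmpty {k // Quotient.mk r (N' k) = c} := ⟨fun k => h' ⟨k, k.2⟩⟩
    exact ⟨Equiv.equivOfIsEmpty _ _⟩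
  let e := fun c => (fiber c).some
  exact ⟨Equiv.ofFiberEquiv (f := fun i => Quotient.mk r (N i)) (g := fun k => Quotient.mk r (N' k))
    e, fun i => (hmk _ _).2 (Equiv.ofFiberEquiv_map (f := fun i => Quotient.mk r (N i)) e i)⟩

end AutInvariant

theorem mainTheorem6 {R : Type*} [Ring R] {M : Type*} [AddCommGroup M] [Module R M]
    (hM : IsAutomorphismInvariant R M)
    {ι : Type*} [DecidableEq ι] (N : ι → Submodule R M)
    (hN : IsIndecomposableDecomposition N) :
    (∀ i, IsLocalRing (Module.End R (N i))) ∧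
    ComplementsDirectSummands N ∧
    (∀ {κ : Type*} [DecidableEq κ] (N' : κ → Submodule R M),
      IsIndecomposableDecomposition N' →
        ∃ σ : ι ≃ κ, ∀ i, Nonempty (N i ≃ₗ[R] N' (σ i))) :=
  ⟨AutInvariant.isLocalRing_end_of_decomposition hM hN,
    AutInvariant.complementsDirectSummands_of_decomposition hM hN,
    fun _ hN' => AutInvariant.exists_equiv_of_isLocalRing hN
      (AutInvariant.isLocalRing_end_of_decomposition hM hN) hN'
      (AutInvariant.isLocalRing_end_of_decomposition hM hN')⟩
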